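/- Let $\mathcal A$ be a finite alphabet, let $\Omega,X\subseteq\mathcal A^{\mathbb N}$ be (one-sided) subshifts, i.e. closed and shift-invariant sets, and let $p\ge 2$ be an integer. Let $X_\Omega^p$ be the multiplicative subshift of all $(x_i)_{i\ge1}\in\mathcal A^{\mathbb N}$ such that $(x_{ip^l})_{l\ge 0}\in\Omega$ for every $i\ge1$ with $p\nmid i$. Let $T^2$ be the binary tree, viewed as the free monoid on $f_1,f_2$ with unit $\epsilon$, let $|g|$ be the length of $g$, and let $\Delta_n=\{g\in T^2:|g|\le n\}$. For $\Lambda\subseteq T^2$ and $Y\subseteq\mathcal A^{T^2}$ let $\mathcal P(\Lambda,Y)=\{(x_g)_{g\in\Lambda}:x\in Y\}$. Let $\Omega\times X$ be the set of $x\in\mathcal A^{T^2}$ such that $(x_{gf_1^j})_{j\ge0}\in\Omega$ and $(x_{gf_2^j})_{j\ge0}\in X$ for all $g\in T^2$. Let $X_\Omega^p\times X$ be the set of $x\in\mathcal A^{T^2}$ such that $(x_{gf_1^j})_{j\ge0}\in X_\Omega^p$ for every $g\in T^2$ that does not end in $f_1$, and $(x_{gf_2^j})_{j\ge0}\in X$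 for all $g\in T^2$. (In the first condition, $x_{gf_1^{j}}$ is the entry with index $j+1$.) A vertex has type $(i,1)$ if it is $f_1^{i-1}$ or of the form $g'f_2f_1^{i-1}$. Each vertex $v$, of type $(i,1)$ say, has two immediate dependents: $vf_1^{ip-i}$ and $vf_2$. Given a vertex $g$, label $g$ by $\epsilon$ and, whenever $v$ is labelled $h$, label its immediate dependents $vf_1^{ip-i}$ and $vf_2$ by $hf_1$ and $hf_2$ respectively. For $k\ge0$ and $i\ge1$ let $\Delta_k^{(i,1)}\subseteq T^2$ be the set of labels of those labelled vertices that lie in $g\Delta_k$, where $g$ is a vertex of type $(i,1)$ (the set does not depend on the choice of $g$). Then the limit defining the entropy $$h(X_\Omega^p\times X)=\lim_{n\to\infty}\frac{\log|\mathcal P(\Delta_n,X_\Omega^p\times X)|}{|\Delta_n|}$$ exists, and $$h(X_\Omega^p\times X)=\sum_{k=0}^\infty\ \sum_{\substack{i>1\\ p\nmid i}}\frac{1}{2^{k+i+1}}\log\left|\mathcal P\left(\Delta_k^{(i,1)},\Omega\times X\right)\right|,$$ where the double series converges absolutely. (If $\Omega\times X=\emptyset$, this is read with the convention $\log 0=0$.)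 -/

import Mathlib

open Filter Topology

/-- The vertices of the binary tree `T²`: the free monoid on two generators. -/
abbrev BinTree : Type := FreeMonoid (Fin 2)

/-- The first generator `f₁` of `T²`. -/
def BinTree.f₁ : BinTree := FreeMonoid.of 0

/-- The second generator `f₂` of `T²`. -/
def BinTree.f₂ : BinTree := FreeMonoid.of 1

open BinTree

/-- The ball `Δ_n`: all vertices joined to the root by at most `n` edges. -/
def treeBall (n : ℕ) : Set BinTree := {g | g.length ≤ n}

/-- `𝒫(Λ, Y)`: the restrictions to `Λ` of the elements of `Y`. -/
def treePatterns {A : Type*} (Λ : Set BinTree) (Y : Set (BinTree → A)) : Set (Λ → A) :=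
  Λ.domRestrict '' Y

/-- `h` is the entropy of `Y ⊆ A^{T²}`: the limit of `log |𝒫(Δ_n, Y)| / |Δ_n|` exists
and equals `h`. -/
def HasTreeEntropy {A : Type*} (Y : Set (BinTree → A)) (h : ℝ) : Prop :=
  Tendsto (fun n : ℕ =>
    Real.log ((treePatterns (treeBall n) Y).ncard : ℝ) / ((treeBall n).ncard : ℝ)) atTop (𝓝 h)

/-- A (one-sided) subshift: a closed subset of `A^ℕ` that is invariant under the shift. -/
def IsOneSidedSubshift {A : Type*} [TopologicalSpace A] (X : Set (ℕ → A)) : Prop :=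
  IsClosed X ∧ ∀ x ∈ X, (fun j => x (j + 1)) ∈ X

/-- The multiplicative subshift `X_Ω^p`. A sequence `(x_1, x_2, x_3, …)` is represented by a
function on `ℕ` whose value at `n` is `x_{n+1}`; thus the condition says that
`(x_{i p^l})_{l ≥ 0}` lies in `Ω` for every `i ≥ 1` that is not divisible by `p`. -/
def multiplicativeSubshift {A : Type*} (p : ℕ) (Ω : Set (ℕ → A)) : Set (ℕ → A) :=
  {x | ∀ i : ℕ, 1 ≤ i → ¬ p ∣ i → (fun l : ℕ => x (i * p ^ l - 1)) ∈ Ω}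

/-- The axial product `X₁ × X₂` on `T²` of two subshifts. -/
def axialProduct {A : Type*} (X₁ X₂ : Set (ℕ → A)) : Set (BinTree → A) :=
  {x | ∀ g : BinTree, (fun j : ℕ => x (g * f₁ ^ j)) ∈ X₁ ∧ (fun j : ℕ => x (g * f₂ ^ j)) ∈ X₂}

/-- The axial product `X_Ω^p × X` on `T²`. Since `X_Ω^p` is not shift invariant, the first
constraint is imposed only along the maximal `f₁`-paths, i.e. those that start at a vertex whose
last generator is not `f₁`. -/
def multiplicativeAxialProduct {A : Type*} (p : ℕ) (Ω X : Set (ℕ → A)) : Set (BinTree → A) :=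
  {x | (∀ g : BinTree, (¬ ∃ g' : BinTree, g = g' * f₁) →
          (fun j : ℕ => x (g * f₁ ^ j)) ∈ multiplicativeSubshift p Ω) ∧
       ∀ g : BinTree, (fun j : ℕ => x (g * f₂ ^ j)) ∈ X}

/-- The position (counted from `1`) of a vertex on the maximal `f₁`-path through it: it equals `i`
exactly if `g = f₁^{i-1}` or `g = g' f₂ f₁^{i-1}`, i.e. if `g` has type `(i, 1)`. -/
def leftPosition (g : BinTree) : ℕ :=
  (g.toList.rtakeWhile (fun s => s = 0)).length + 1

/-- The two immediate dependents of a vertex `v`: its `f₂`-child, and the vertex on the same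
maximal `f₁`-path whose position is `p` times the position of `v`. -/
def dependentStep (p : ℕ) (v : BinTree) (s : Fin 2) : BinTree :=
  if s = 0 then v * f₁ ^ (leftPosition v * p - leftPosition v) else v * f₂

/-- The vertices that depend on `g`, labelled by `T²`: `g` gets the label `ε`, and if `v` has
the label `h`, then its two immediate dependents have the labels `h f₁` and `h f₂`. The inverse of
this labelling is the reshaping of the set of dependents of `g` into the tree `T²`. -/
def dependentVertex (p : ℕ) (g h : BinTree) : BinTree :=
  h.toList.foldl (dependentStep p) g

/-- `Δ_k^{(i,1)}`: take the vertex `g = f₁^{i-1}` of type `(i, 1)` (every vertex of that type gives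
the same set), and reshape into `T²` the set of those vertices of `g Δ_k` that depend on `g`. -/
def reshapedBall (p i k : ℕ) : Set BinTree :=
  {h | ∃ g' ∈ treeBall k, dependentVertex p (f₁ ^ (i - 1)) h = f₁ ^ (i - 1) * g'}

/-!
The immediate-dependence relation makes the vertices of `T²` into a forest whose roots are `ε` and
the vertices of type `(i, 1)` with `i > 1` and `p ∤ i` (`independentVertices`). Each vertex has
exactly one label relative to exactly one of these roots (`exists_dependentVertex_eq`,
`dependentVertex_injective`). Writing a position on an `f₁`-path as `i p ^ m` with `p ∤ i`, the
constraints of `X_Ω^p × X` become the constraints of `Ω × X` on each reshaped tree separately, so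
`X_Ω^p × X` is a full product of copies of `Ω × X` (`mem_multiplicativeAxialProduct_iff`; the shift
invariance of `Ω` is used here). Since the distance from a vertex to a dependent depends only on the
position of the vertex and on the label, the class of a root `r` of type `(i, 1)` meets `Δ_n` in a
copy of `Δ_{n-|r|}^{(i,1)}`. Hence `|𝒫(Δ_n, X_Ω^p × X)|` is the product of the numbers
`|𝒫(Δ_{n-|r|}^{(i,1)}, Ω × X)|`, over all roots `r` in `Δ_n`
(`ncard_treePatterns_multiplicativeAxialProduct`).

Taking logarithms and dividing by `|Δ_n|` gives a sum over pairs `(k, i)`, in which the pattern count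
of `Δ_k^{(i,1)}` is weighted with the frequency of the vertices of type `(i, 1)` at distance `n - k`
from `ε`, and this frequency tends to `2^{-(k+i+1)}` (`tendsto_typeFrequency`). The limit may be
taken term by term by dominated convergence. The trivial bound `|Δ_k^{(i,1)}| ≤ 2^{k+1} - 1` is too
weak for that; what makes it work is that `|Δ_k^{(i,1)}| ≤ 10 (19/10)^k` for all `i`
(`ncard_reshapedBall_add_one_le`). The same bound shows that the class of `ε`, which has no
counterpart in the limiting series, contributes nothing.
-/

/-! ### Positions on `f₁`-paths -/

theorem BinTree.length_mul_f₁_pow (g : BinTree) (m : ℕ) :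
    (g * f₁ ^ m).length = g.length + m := by
  induction m with
  | zero => simp
  | succ m ih => rw [pow_succ, ← mul_assoc, FreeMonoid.length_mul, ih]; simp [f₁]; omega

theorem BinTree.length_mul_f₂ (g : BinTree) : (g * f₂).length = g.length + 1 := by
  simp [f₂]

theorem leftPosition_one : leftPosition 1 = 1 := by
  simp [leftPosition]

theorem leftPosition_pos (g : BinTree) : 0 < leftPosition g := Nat.succ_pos _

theorem leftPosition_mul_f₁ (g : BinTree) : leftPosition (g * f₁) = leftPosition g + 1 := by
  simp [leftPosition, f₁]

theorem leftPosition_mul_f₂ (g : BinTree) : leftPosition (g * f₂) = 1 := by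
  simp [leftPosition, f₂]

theorem leftPosition_mul_f₁_pow (g : BinTree) (m : ℕ) :
    leftPosition (g * f₁ ^ m) = leftPosition g + m := by
  induction m with
  | zero => simp
  | succ m ih => rw [pow_succ, ← mul_assoc, leftPosition_mul_f₁, ih, add_assoc]

/-- Induction on vertices, from the root towards the leaves. -/
theorem BinTree.induction_right {P : BinTree → Prop} (one : P 1) (mul_f₁ : ∀ g, P g → P (g * f₁))
    (mul_f₂ : ∀ g, P g → P (g * f₂)) (g : BinTree) : P g := by
  have key : ∀ l : List (Fin 2), P (FreeMonoid.ofList l) := by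
    intro l
    induction l using List.reverseRecOn with
    | nil => exact one
    | append_singleton l a ih =>
      fin_cases a
      · exact mul_f₁ _ ih
      · exact mul_f₂ _ ih
  exact key g.toList

theorem BinTree.eq_one_or_mul (g : BinTree) : g = 1 ∨ (∃ g', g = g' * f₁) ∨ ∃ g', g = g' * f₂ := by
  induction g using BinTree.induction_right with
  | one => exact Or.inl rfl
  | mul_f₁ g _ => exact Or.inr (Or.inl ⟨g, rfl⟩)
  | mul_f₂ g _ => exact Or.inr (Or.inr ⟨g, rfl⟩)

theorem leftPosition_eq_one_iff (g : BinTree) :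
    leftPosition g = 1 ↔ ¬ ∃ g' : BinTree, g = g' * f₁ := by
  constructor
  · rintro h ⟨g', rfl⟩
    rw [leftPosition_mul_f₁] at h
    have := leftPosition_pos g'
    omega
  · intro h
    rcases g.eq_one_or_mul with rfl | h' | ⟨g', rfl⟩
    · exact leftPosition_one
    · exact absurd h' h
    · exact leftPosition_mul_f₂ g'

/-- Every vertex lies on the maximal `f₁`-path that starts at a vertex of position `1`. -/
theorem exists_eq_mul_f₁_pow (g : BinTree) :
    ∃ g₀ : BinTree, leftPosition g₀ = 1 ∧ g = g₀ * f₁ ^ (leftPosition g - 1) := by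
  induction g using BinTree.induction_right with
  | one => exact ⟨1, leftPosition_one, by simp [leftPosition_one]⟩
  | mul_f₁ g ih =>
    obtain ⟨g₀, h₀, h⟩ := ih
    refine ⟨g₀, h₀, ?_⟩
    have hp := leftPosition_pos g
    rw [leftPosition_mul_f₁, Nat.add_sub_cancel]
    conv_lhs => rw [h]
    rw [mul_assoc, ← pow_succ, Nat.sub_add_cancel hp]
  | mul_f₂ g _ => exact ⟨g * f₂, leftPosition_mul_f₂ g, by simp [leftPosition_mul_f₂]⟩

/-! ### The dependence relation -/

theorem dependentStep_zero (p : ℕ) (v : BinTree) :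
    dependentStep p v 0 = v * f₁ ^ (leftPosition v * p - leftPosition v) := by
  simp [dependentStep]

theorem dependentStep_one (p : ℕ) (v : BinTree) : dependentStep p v 1 = v * f₂ := by
  simp [dependentStep]

theorem leftPosition_dependentStep_zero {p : ℕ} (hp : 0 < p) (v : BinTree) :
    leftPosition (dependentStep p v 0) = leftPosition v * p := by
  rw [dependentStep_zero, leftPosition_mul_f₁_pow]
  exact Nat.add_sub_cancel' (Nat.le_mul_of_pos_right _ hp)

theorem leftPosition_dependentStep_one (p : ℕ) (v : BinTree) :
    leftPosition (dependentStep p v 1) = 1 := by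
  rw [dependentStep_one, leftPosition_mul_f₂]

theorem dependentVertex_one (p : ℕ) (g : BinTree) : dependentVertex p g 1 = g := rfl

theorem dependentVertex_mul_f₁ (p : ℕ) (g h : BinTree) :
    dependentVertex p g (h * f₁) = dependentStep p (dependentVertex p g h) 0 := by
  simp [dependentVertex, f₁]

theorem dependentVertex_mul_f₂ (p : ℕ) (g h : BinTree) :
    dependentVertex p g (h * f₂) = dependentStep p (dependentVertex p g h) 1 := by
  simp [dependentVertex, f₂]

theorem dependentVertex_mul_f₁_pow {p : ℕ} (hp : 0 < p) (g h : BinTree) (l : ℕ) :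
    dependentVertex p g (h * f₁ ^ l) = dependentVertex p g h *
      f₁ ^ (leftPosition (dependentVertex p g h) * p ^ l
        - leftPosition (dependentVertex p g h)) := by
  induction l with
  | zero => simp
  | succ l ih =>
    rw [pow_succ, ← mul_assoc, dependentVertex_mul_f₁, dependentStep_zero, ih,
      leftPosition_mul_f₁_pow, mul_assoc, ← pow_add]
    have h1 : leftPosition (dependentVertex p g h) ≤ leftPosition (dependentVertex p g h) * p ^ l :=
      Nat.le_mul_of_pos_right _ (pow_pos hp l)
    have h2 := Nat.le_mul_of_pos_right (leftPosition (dependentVertex p g h) * p ^ l) hp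
    rw [Nat.add_sub_cancel' h1, pow_succ, ← mul_assoc]
    congr 2
    omega

theorem dependentVertex_mul_f₂_pow (p : ℕ) (g h : BinTree) (l : ℕ) :
    dependentVertex p g (h * f₂ ^ l) = dependentVertex p g h * f₂ ^ l := by
  induction l with
  | zero => simp
  | succ l ih =>
    rw [pow_succ, ← mul_assoc, dependentVertex_mul_f₂, dependentStep_one, ih, mul_assoc]

/-- The vertices that are not an immediate dependent of any vertex: the root of the tree, and the
vertices whose position exceeds `1` and is not a multiple of `p`. -/
def independentVertices (p : ℕ) : Set BinTree :=
  {g | g = 1 ∨ (1 < leftPosition g ∧ ¬ p ∣ leftPosition g)}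

theorem dependentStep_notMem_independentVertices {p : ℕ} (hp : 1 < p) (v : BinTree) (s : Fin 2) :
    dependentStep p v s ∉ independentVertices p := by
  have hp0 : 0 < p := by omega
  rintro (h | ⟨h1, h2⟩)
  · fin_cases s
    · have h' := leftPosition_dependentStep_zero hp0 v
      have hv := Nat.mul_le_mul (leftPosition_pos v) hp
      simp only [Fin.zero_eta] at h
      rw [h, leftPosition_one] at h'
      omega
    · have h' := congrArg FreeMonoid.length h
      simp only [Fin.mk_one, dependentStep_one, length_mul_f₂, FreeMonoid.length_one] at h'
      omega
  · fin_cases s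
    · exact h2 ⟨leftPosition v, by simp [leftPosition_dependentStep_zero hp0, mul_comm]⟩
    · simp [leftPosition_dependentStep_one] at h1

theorem dependentStep_injective {p : ℕ} (hp : 1 < p) {v w : BinTree} {s t : Fin 2}
    (h : dependentStep p v s = dependentStep p w t) : v = w ∧ s = t := by
  have hp0 : 0 < p := by omega
  have hpos := congrArg leftPosition h
  have two_le : ∀ u : BinTree, 2 ≤ leftPosition u * p := fun u =>
    Nat.mul_le_mul (leftPosition_pos u) hp
  fin_cases s <;> fin_cases t <;> simp only [Fin.zero_eta, Fin.mk_one] at h hpos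
  · rw [leftPosition_dependentStep_zero hp0, leftPosition_dependentStep_zero hp0] at hpos
    have hpos' := Nat.eq_of_mul_eq_mul_right hp0 hpos
    rw [dependentStep_zero, dependentStep_zero, hpos'] at h
    exact ⟨mul_right_cancel h, rfl⟩
  · rw [leftPosition_dependentStep_zero hp0, leftPosition_dependentStep_one] at hpos
    have := two_le v
    omega
  · rw [leftPosition_dependentStep_zero hp0, leftPosition_dependentStep_one] at hpos
    have := two_le w
    omega
  · rw [dependentStep_one, dependentStep_one] at h
    exact ⟨mul_right_cancel h, rfl⟩

theorem exists_dependentStep_eq {p : ℕ} (hp : 1 < p) {g : BinTree}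
    (hg : g ∉ independentVertices p) :
    ∃ v s, dependentStep p v s = g ∧ v.length < g.length := by
  have hp0 : 0 < p := by omega
  simp only [independentVertices, Set.mem_ofPred_eq, not_or, not_and, not_not] at hg
  obtain ⟨hg1, hg2⟩ := hg
  rcases eq_or_lt_of_le (Nat.one_le_iff_ne_zero.2 (leftPosition_pos g).ne') with h | h
  · rcases g.eq_one_or_mul with h' | h' | ⟨g', rfl⟩
    · exact absurd h' hg1
    · exact absurd h' ((leftPosition_eq_one_iff g).1 h.symm)
    · exact ⟨g', 1, dependentStep_one p g', by rw [length_mul_f₂]; omega⟩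
  · obtain ⟨j, hj⟩ := hg2 h
    obtain ⟨g₀, h₀, hg₀⟩ := exists_eq_mul_f₁_pow g
    have hj0 : 0 < j := Nat.pos_of_ne_zero (by rintro rfl; simp at hj; omega)
    have hjp : 2 * j ≤ p * j := Nat.mul_le_mul_right j hp
    have hv : leftPosition (g₀ * f₁ ^ (j - 1)) = j := by
      rw [leftPosition_mul_f₁_pow, h₀]; omega
    refine ⟨g₀ * f₁ ^ (j - 1), 0, ?_, ?_⟩
    · rw [dependentStep_zero, hv, mul_assoc, ← pow_add, hg₀, hj]
      congr 2
      rw [mul_comm j p]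
      omega
    · rw [hg₀, length_mul_f₁_pow, length_mul_f₁_pow, hj]
      omega

/-- Every vertex depends on an independent one. -/
theorem exists_dependentVertex_eq {p : ℕ} (hp : 1 < p) (g : BinTree) :
    ∃ r ∈ independentVertices p, ∃ h, dependentVertex p r h = g := by
  induction hn : g.length using Nat.strong_induction_on generalizing g with
  | _ n ih =>
    by_cases hg : g ∈ independentVertices p
    · exact ⟨g, hg, 1, rfl⟩
    · obtain ⟨v, s, rfl, hlt⟩ := exists_dependentStep_eq hp hg
      obtain ⟨r, hr, h, rfl⟩ := ih _ (hn ▸ hlt) v rfl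
      fin_cases s
      · exact ⟨r, hr, h * f₁, dependentVertex_mul_f₁ p r h⟩
      · exact ⟨r, hr, h * f₂, dependentVertex_mul_f₂ p r h⟩

/-- A vertex depends on only one independent vertex, and has only one label relative to it. -/
theorem dependentVertex_injective {p : ℕ} (hp : 1 < p) {r r' : BinTree}
    (hr : r ∈ independentVertices p) (hr' : r' ∈ independentVertices p) {h h' : BinTree}
    (heq : dependentVertex p r h = dependentVertex p r' h') : r = r' ∧ h = h' := by
  induction h using BinTree.induction_right generalizing h' with
  | one =>
    rw [dependentVertex_one] at heq
    rcases h'.eq_one_or_mul with rfl | ⟨k, rfl⟩ | ⟨k, rfl⟩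
    · exact ⟨heq, rfl⟩
    · rw [dependentVertex_mul_f₁] at heq
      exact absurd (heq ▸ hr) (dependentStep_notMem_independentVertices hp _ _)
    · rw [dependentVertex_mul_f₂] at heq
      exact absurd (heq ▸ hr) (dependentStep_notMem_independentVertices hp _ _)
  | mul_f₁ h ih =>
    rw [dependentVertex_mul_f₁] at heq
    rcases h'.eq_one_or_mul with rfl | ⟨k, rfl⟩ | ⟨k, rfl⟩
    · rw [dependentVertex_one] at heq
      exact absurd (heq ▸ hr') (dependentStep_notMem_independentVertices hp _ _)
    · rw [dependentVertex_mul_f₁] at heq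
      obtain ⟨h1, h2⟩ := ih (dependentStep_injective hp heq).1
      exact ⟨h1, by rw [h2]⟩
    · rw [dependentVertex_mul_f₂] at heq
      exact absurd (dependentStep_injective hp heq).2 (by decide)
  | mul_f₂ h ih =>
    rw [dependentVertex_mul_f₂] at heq
    rcases h'.eq_one_or_mul with rfl | ⟨k, rfl⟩ | ⟨k, rfl⟩
    · rw [dependentVertex_one] at heq
      exact absurd (heq ▸ hr') (dependentStep_notMem_independentVertices hp _ _)
    · rw [dependentVertex_mul_f₁] at heq
      exact absurd (dependentStep_injective hp heq).2 (by decide)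
    · rw [dependentVertex_mul_f₂] at heq
      obtain ⟨h1, h2⟩ := ih (dependentStep_injective hp heq).1
      exact ⟨h1, by rw [h2]⟩

/-! ### Decoupling of the multiplicative axial product -/

theorem IsOneSidedSubshift.shift_mem {A : Type*} [TopologicalSpace A] {X : Set (ℕ → A)}
    (hX : IsOneSidedSubshift X) {x : ℕ → A} (hx : x ∈ X) (m : ℕ) :
    (fun j => x (m + j)) ∈ X := by
  induction m with
  | zero => simpa using hx
  | succ m ih =>
    have := hX.2 _ ih
    simpa only [add_assoc, add_comm 1] using this

/-- A configuration lies in `X_Ω^p × X` exactly if its restriction to each class of mutually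
dependent vertices, reshaped into the tree, lies in `Ω × X`. -/
theorem mem_multiplicativeAxialProduct_iff {A : Type*} [TopologicalSpace A] {p : ℕ} (hp : 1 < p)
    {Ω : Set (ℕ → A)} (hΩ : IsOneSidedSubshift Ω) (X : Set (ℕ → A)) (x : BinTree → A) :
    x ∈ multiplicativeAxialProduct p Ω X ↔
      ∀ r ∈ independentVertices p, (fun h => x (dependentVertex p r h)) ∈ axialProduct Ω X := by
  have hp0 : 0 < p := by omega
  constructor
  · rintro ⟨h1, h2⟩ r - h
    simp only [dependentVertex_mul_f₁_pow hp0, dependentVertex_mul_f₂_pow]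
    refine ⟨?_, h2 _⟩
    generalize dependentVertex p r h = v
    obtain ⟨g₀, hg₀, hv⟩ := exists_eq_mul_f₁_pow v
    -- write the position of `v` as `i * p ^ m` with `p` not dividing `i`
    obtain ⟨m, i, hi, hm⟩ := Nat.exists_eq_pow_mul_and_not_dvd (leftPosition_pos v).ne' p (by omega)
    have hi0 : 0 < i := Nat.pos_of_ne_zero (by rintro rfl; simp at hi)
    have key := hΩ.shift_mem (h1 g₀ ((leftPosition_eq_one_iff g₀).1 hg₀) i hi0 hi) m
    convert key using 2 with j
    conv_lhs => rw [hv, mul_assoc]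
    simp only [leftPosition_mul_f₁_pow, hg₀, hm, pow_add]
    have e1 : 0 < p ^ m * i := Nat.mul_pos (pow_pos hp0 m) hi0
    have e2 : p ^ m * i ≤ p ^ m * i * p ^ j := Nat.le_mul_of_pos_right _ (pow_pos hp0 j)
    have e3 : i * (p ^ m * p ^ j) = p ^ m * i * p ^ j := by ring
    rw [e3, Nat.add_sub_cancel' e1, ← pow_add f₁]
    congr 3
    omega
  · intro H
    refine ⟨fun g hg i hi0 hi => ?_, fun g => ?_⟩
    · obtain ⟨r, hr, h, hh⟩ := exists_dependentVertex_eq hp (g * f₁ ^ (i - 1))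
      have key := (H r hr h).1
      simp only [dependentVertex_mul_f₁_pow hp0, hh, leftPosition_mul_f₁_pow,
        (leftPosition_eq_one_iff g).2 hg, Nat.add_sub_cancel' hi0, mul_assoc, ← pow_add] at key
      convert key using 5 with l
      have := Nat.le_mul_of_pos_right i (pow_pos hp0 l)
      omega
    · obtain ⟨r, hr, h, hh⟩ := exists_dependentVertex_eq hp g
      have key := (H r hr h).2
      simpa only [dependentVertex_mul_f₂_pow, hh] using key

/-! ### Depths of dependents and the size of `Δ_k^{(i,1)}` -/

/-- The distance from a vertex of position `i` to its dependent with the label `h`. -/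
def dependentDepth (p : ℕ) : ℕ → List (Fin 2) → ℕ
  | _, [] => 0
  | i, s :: h => if s = 0 then i * p - i + dependentDepth p (i * p) h else 1 + dependentDepth p 1 h

/-- Each dependent of `g` lies in the subtree at `g`, at a distance that depends only on the
position of `g` and the label. -/
theorem exists_foldl_dependentStep_eq {p : ℕ} (hp : 0 < p) (g : BinTree) (h : List (Fin 2)) :
    ∃ g' : BinTree, g'.length = dependentDepth p (leftPosition g) h ∧
      h.foldl (dependentStep p) g = g * g' := by
  induction h generalizing g with
  | nil => exact ⟨1, rfl, by simp⟩
  | cons s h ih =>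
    obtain ⟨g', h1, h2⟩ := ih (dependentStep p g s)
    rw [List.foldl_cons, h2]
    fin_cases s
    · refine ⟨f₁ ^ (leftPosition g * p - leftPosition g) * g', ?_, ?_⟩
      · have h3 := length_mul_f₁_pow 1 (leftPosition g * p - leftPosition g)
        rw [one_mul, FreeMonoid.length_one, zero_add] at h3
        rw [FreeMonoid.length_mul, h1, h3]
        simp [dependentDepth, leftPosition_dependentStep_zero hp]
      · simp [dependentStep_zero, mul_assoc]
    · refine ⟨f₂ * g', ?_, ?_⟩
      · rw [FreeMonoid.length_mul, h1]
        simp [dependentDepth, leftPosition_dependentStep_one, f₂]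
      · simp [dependentStep_one, mul_assoc]

theorem length_dependentVertex {p : ℕ} (hp : 0 < p) (g h : BinTree) :
    (dependentVertex p g h).length = g.length + dependentDepth p (leftPosition g) h.toList := by
  obtain ⟨g', h1, h2⟩ := exists_foldl_dependentStep_eq hp g h.toList
  rw [dependentVertex, h2, FreeMonoid.length_mul, h1]

theorem mem_reshapedBall_iff {p : ℕ} (hp : 0 < p) {i : ℕ} (hi : 0 < i) (k : ℕ) (h : BinTree) :
    h ∈ reshapedBall p i k ↔ dependentDepth p i h.toList ≤ k := by
  have hpos : leftPosition (f₁ ^ (i - 1)) = i := by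
    have := leftPosition_mul_f₁_pow 1 (i - 1)
    rw [one_mul, leftPosition_one] at this
    omega
  obtain ⟨g', h1, h2⟩ := exists_foldl_dependentStep_eq hp (f₁ ^ (i - 1)) h.toList
  rw [hpos] at h1
  rw [← h1]
  constructor
  · rintro ⟨g'', hg'', h3⟩
    rw [dependentVertex, h2] at h3
    rw [mul_left_cancel h3]
    exact hg''
  · exact fun hk => ⟨g', hk, h2⟩

theorem length_le_dependentDepth {p : ℕ} (hp : 1 < p) {i : ℕ} (hi : 0 < i) (h : List (Fin 2)) :
    h.length ≤ dependentDepth p i h := by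
  induction h generalizing i with
  | nil => simp
  | cons s h ih =>
    have h1 := ih Nat.one_pos
    have h2 := ih (Nat.mul_pos hi (show 0 < p by omega))
    have h3 : i * 2 ≤ i * p := Nat.mul_le_mul_left i hp
    simp only [dependentDepth, List.length_cons]
    split_ifs <;> omega

theorem finite_treeBall (n : ℕ) : (treeBall n).Finite := List.finite_length_le (Fin 2) n

theorem finite_reshapedBall {p : ℕ} (hp : 1 < p) {i : ℕ} (hi : 0 < i) (k : ℕ) :
    (reshapedBall p i k).Finite :=
  (finite_treeBall k).subset fun h hh =>
    (length_le_dependentDepth hp hi h.toList).trans ((mem_reshapedBall_iff (by omega) hi k h).1 hh)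

theorem reshapedBall_subset {p : ℕ} (hp : 0 < p) {i : ℕ} (hi : 0 < i) (k : ℕ) :
    reshapedBall p i k ⊆ insert 1 (
      (fun h => f₁ * h) '' {h | i * p - i ≤ k ∧ h ∈ reshapedBall p (i * p) (k - (i * p - i))} ∪
      (fun h => f₂ * h) '' {h | 1 ≤ k ∧ h ∈ reshapedBall p 1 (k - 1)}) := by
  intro h hh
  rw [mem_reshapedBall_iff hp hi] at hh
  cases h using FreeMonoid.casesOn with
  | one => exact Set.mem_insert _ _
  | of_mul s h =>
    rw [FreeMonoid.toList_of_mul, dependentDepth] at hh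
    refine Set.mem_insert_of_mem _ ?_
    fin_cases s
    · refine Or.inl ⟨h, ⟨?_, (mem_reshapedBall_iff hp (Nat.mul_pos hi hp) _ _).2 ?_⟩, rfl⟩ <;>
      · simp at hh; omega
    · refine Or.inr ⟨h, ⟨?_, (mem_reshapedBall_iff hp Nat.one_pos _ _).2 ?_⟩, rfl⟩ <;>
      · simp at hh; omega

theorem ncard_reshapedBall_zero_le {p : ℕ} (hp : 1 < p) {i : ℕ} (hi : 0 < i) :
    (reshapedBall p i 0).ncard ≤ 1 := by
  rw [← Set.ncard_singleton (1 : BinTree)]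
  refine Set.ncard_le_ncard (fun h hh => ?_) (Set.finite_singleton _)
  rw [mem_reshapedBall_iff (by omega) hi] at hh
  have := length_le_dependentDepth hp hi h.toList
  exact FreeMonoid.length_eq_zero.1 (Nat.le_zero.1 (this.trans hh))

theorem reshapedBall_mono {p : ℕ} (hp : 0 < p) {i : ℕ} (hi : 0 < i) {k l : ℕ} (hkl : k ≤ l) :
    reshapedBall p i k ⊆ reshapedBall p i l := fun h hh =>
  (mem_reshapedBall_iff hp hi l h).2 (((mem_reshapedBall_iff hp hi k h).1 hh).trans hkl)

/-- If the `f₁`-dependent is at distance at least `d`, the dependents split into the vertex itself,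
those behind the `f₁`-dependent and those behind the `f₂`-dependent. -/
theorem ncard_reshapedBall_le {p : ℕ} (hp : 1 < p) {i : ℕ} (hi : 0 < i) {d : ℕ}
    (hd : d ≤ i * p - i) {k : ℕ} (hk : d ≤ k) :
    (reshapedBall p i k).ncard ≤
      1 + ((reshapedBall p (i * p) (k - d)).ncard + (reshapedBall p 1 (k - 1)).ncard) := by
  have hp0 : 0 < p := by omega
  have hip : 0 < i * p := Nat.mul_pos hi hp0
  have fin1 := finite_reshapedBall hp hip (k - d)
  have fin2 := finite_reshapedBall hp Nat.one_pos (k - 1)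
  have hsub : reshapedBall p i k ⊆ insert 1 ((fun h => f₁ * h) '' reshapedBall p (i * p) (k - d) ∪
      (fun h => f₂ * h) '' reshapedBall p 1 (k - 1)) := by
    refine (reshapedBall_subset hp0 hi k).trans (Set.insert_subset_insert
      (Set.union_subset_union (Set.image_mono ?_) (Set.image_mono fun h hh => hh.2)))
    exact fun h hh => reshapedBall_mono hp0 hip (by omega) hh.2
  refine (Set.ncard_le_ncard hsub (((fin1.image _).union (fin2.image _)).insert 1)).trans ?_
  refine (Set.ncard_insert_le _ _).trans ?_
  rw [add_comm]
  gcongr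
  exact (Set.ncard_union_le _ _).trans
    (add_le_add (Set.ncard_image_le fin1) (Set.ncard_image_le fin2))

/-- The sets `Δ_k^{(i,1)}` grow at a rate strictly below that of the balls of `T²`, uniformly
in `i`. The reason is that from a vertex of position `> 1`, as is every `f₁`-dependent, the step to
the next `f₁`-dependent covers a distance of at least `2`. -/
theorem ncard_reshapedBall_add_one_le {p : ℕ} (hp : 1 < p) (k : ℕ) {i : ℕ} (hi : 0 < i) :
    ((reshapedBall p i k).ncard : ℝ) + 1 ≤ 10 * (19 / 10) ^ k ∧
      (1 < i → ((reshapedBall p i k).ncard : ℝ) + 1 ≤ 9 * (19 / 10) ^ k) := by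
  -- `(10, 9)` is a supersolution, with the factor `19 / 10` per unit of distance, of the linear
  -- recursion for the numbers of dependents of a vertex of position `1` and of position `> 1`
  have hp0 : 0 < p := by omega
  induction k using Nat.strong_induction_on generalizing i with
  | _ k ih =>
    have hip : 0 < i * p := Nat.mul_pos hi hp0
    have hip1 : 1 < i * p := lt_of_lt_of_le hp (Nat.le_mul_of_pos_left p hi)
    have h2p : i * 2 ≤ i * p := Nat.mul_le_mul_left i hp
    rcases k with _ | k
    · have h0 : ((reshapedBall p i 0).ncard : ℝ) ≤ 1 := by
        exact_mod_cast ncard_reshapedBall_zero_le hp hi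
      constructor
      · norm_num; linarith
      · intro; norm_num; linarith
    have ih1 := (ih k (by omega) Nat.one_pos).1
    have ih2 := (ih k (by omega) hip).2 hip1
    have hx : (0 : ℝ) < (19 / 10) ^ k := by positivity
    have hrec := ncard_reshapedBall_le hp hi (d := 1) (by omega) (k := k + 1) (by omega)
    rw [Nat.add_sub_cancel] at hrec
    have hrec' : ((reshapedBall p i (k + 1)).ncard : ℝ) ≤
      1 + ((reshapedBall p (i * p) k).ncard + (reshapedBall p 1 k).ncard) := by exact_mod_cast hrec
    refine ⟨by rw [pow_succ]; linarith, fun hi1 => ?_⟩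
    rcases k with _ | k
    · have h1 : ((reshapedBall p (i * p) 0).ncard : ℝ) ≤ 1 := by
        exact_mod_cast ncard_reshapedBall_zero_le hp hip
      have h2 : ((reshapedBall p 1 0).ncard : ℝ) ≤ 1 := by
        exact_mod_cast ncard_reshapedBall_zero_le hp Nat.one_pos
      norm_num at hrec' ⊢
      linarith
    · have ih3 := (ih k (by omega) hip).2 hip1
      have hy : (0 : ℝ) < (19 / 10) ^ k := by positivity
      have hrec2 := ncard_reshapedBall_le hp hi (d := 2) (by omega) (k := k + 2) (by omega)
      have hrec2' : ((reshapedBall p i (k + 2)).ncard : ℝ) ≤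
          1 + ((reshapedBall p (i * p) k).ncard + (reshapedBall p 1 (k + 1)).ncard) := by
        exact_mod_cast hrec2
      rw [pow_succ] at ih1 ⊢
      rw [pow_succ]
      linarith

/-! ### Pattern counts and their logarithms -/

theorem log_ncard_treePatterns_le {A : Type*} [Finite A] {Λ : Set BinTree} (hΛ : Λ.Finite)
    (Y : Set (BinTree → A)) :
    Real.log ((treePatterns Λ Y).ncard : ℝ) ≤ Λ.ncard * Real.log (Nat.card A) := by
  have := hΛ.to_subtype
  rcases Nat.eq_zero_or_pos (treePatterns Λ Y).ncard with h0 | h0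
  · rw [h0, Nat.cast_zero, Real.log_zero]
    exact mul_nonneg (Nat.cast_nonneg _) (Real.log_natCast_nonneg _)
  · have hle : (treePatterns Λ Y).ncard ≤ Nat.card A ^ Λ.ncard := by
      rw [← Nat.card_coe_set_eq Λ, ← Nat.card_fun]
      exact Set.ncard_le_card _
    rw [← Real.log_pow]
    exact Real.log_le_log (by exact_mod_cast h0) (by exact_mod_cast hle)

theorem log_ncard_treePatterns_reshapedBall_le {A : Type*} [Finite A] {p : ℕ} (hp : 1 < p)
    {i : ℕ} (hi : 0 < i) (k : ℕ) (Y : Set (BinTree → A)) :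
    Real.log ((treePatterns (reshapedBall p i k) Y).ncard : ℝ) ≤
      10 * Real.log (Nat.card A) * (19 / 10) ^ k := by
  have h1 := (ncard_reshapedBall_add_one_le hp k hi).1
  have h2 := log_ncard_treePatterns_le (finite_reshapedBall hp hi k) Y
  have h3 : 0 ≤ Real.log (Nat.card A : ℝ) := Real.log_natCast_nonneg _
  have h4 := mul_le_mul_of_nonneg_right
    (show ((reshapedBall p i k).ncard : ℝ) ≤ 10 * (19 / 10) ^ k by linarith) h3
  linarith

theorem treePatterns_eq_empty_iff {A : Type*} {Λ : Set BinTree} {Y : Set (BinTree → A)} :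
    treePatterns Λ Y = ∅ ↔ Y = ∅ := Set.image_eq_empty

theorem one_mem_independentVertices (p : ℕ) : (1 : BinTree) ∈ independentVertices p := Or.inl rfl

/-- The patterns of the multiplicative axial product on `Δ_n` decouple: they correspond to the
independent choices of one pattern of `Ω × X` for each class of dependent vertices meeting `Δ_n`. -/
theorem ncard_treePatterns_multiplicativeAxialProduct {A : Type*} [TopologicalSpace A]
    {p : ℕ} (hp : 1 < p) {Ω : Set (ℕ → A)} (hΩ : IsOneSidedSubshift Ω) (X : Set (ℕ → A)) (n : ℕ)
    {R : Finset BinTree} (hR : ∀ r, r ∈ R ↔ r ∈ independentVertices p ∧ r.length ≤ n) :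
    (treePatterns (treeBall n) (multiplicativeAxialProduct p Ω X)).ncard =
      ∏ r ∈ R, (treePatterns (reshapedBall p (leftPosition r) (n - r.length))
        (axialProduct Ω X)).ncard := by
  classical
  have hp0 : 0 < p := by omega
  set Y := axialProduct Ω X with hY
  have hmem : ∀ r ∈ R, ∀ h : BinTree, h ∈ reshapedBall p (leftPosition r) (n - r.length) ↔
      dependentVertex p r h ∈ treeBall n := by
    intro r hr h
    have h1 := ((hR r).1 hr).2
    rw [mem_reshapedBall_iff hp0 (leftPosition_pos r)]
    change _ ↔ (dependentVertex p r h).length ≤ n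
    rw [length_dependentVertex hp0]
    omega
  -- the map that cuts a pattern on `Δ_n` into its classes
  let Φ : (treeBall n → A) →
      (∀ r : R, reshapedBall p (leftPosition r.1) (n - r.1.length) → A) :=
    fun u r h => u ⟨dependentVertex p r h, (hmem r r.2 h).1 h.2⟩
  have hΦ : Function.Injective Φ := by
    intro u v huv
    ext ⟨g, hg⟩
    obtain ⟨r, hr, h, rfl⟩ := exists_dependentVertex_eq hp g
    have hrR : r ∈ R := (hR r).2 ⟨hr, by
      have : (dependentVertex p r h).length ≤ n := hg
      rw [length_dependentVertex hp0] at this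
      omega⟩
    exact congrFun (congrFun huv ⟨r, hrR⟩) ⟨h, (hmem r hrR h).2 hg⟩
  have himage : Φ '' treePatterns (treeBall n) (multiplicativeAxialProduct p Ω X) =
      Set.pi Set.univ fun r : R => treePatterns
        (reshapedBall p (leftPosition r.1) (n - r.1.length)) Y := by
    ext w
    constructor
    · rintro ⟨_, ⟨x, hx, rfl⟩, rfl⟩ r -
      exact ⟨_, (mem_multiplicativeAxialProduct_iff hp hΩ X x).1 hx r ((hR r).1 r.2).1, rfl⟩
    · intro hw
      choose y hyY hyw using fun r : R => hw r (Set.mem_univ r)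
      have h1R : (1 : BinTree) ∈ R := (hR 1).2 ⟨one_mem_independentVertices p, Nat.zero_le n⟩
      choose root hroot label hlabel using fun g : BinTree => exists_dependentVertex_eq hp g
      -- the classes that do not meet `Δ_n` are filled with the configuration chosen at the root
      let z : BinTree → BinTree → A := fun r => if hr : r ∈ R then y ⟨r, hr⟩ else y ⟨1, h1R⟩
      have hz : ∀ r, z r ∈ Y := by
        intro r
        by_cases hr : r ∈ R
        · simpa [z, hr] using hyY ⟨r, hr⟩
        · simpa [z, hr] using hyY ⟨1, h1R⟩
      have hx : ∀ r ∈ independentVertices p,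
          (fun h => z (root (dependentVertex p r h)) (label (dependentVertex p r h))) = z r := by
        intro r hr
        ext h
        obtain ⟨h1, h2⟩ := dependentVertex_injective hp (hroot _) hr
          (hlabel (dependentVertex p r h))
        rw [h1, h2]
      refine ⟨_, ⟨fun g => z (root g) (label g),
        (mem_multiplicativeAxialProduct_iff hp hΩ X _).2 fun r hr => ?_, rfl⟩, ?_⟩
      · rw [hx r hr]
        exact hz r
      · ext r h
        have h1 := congrFun (hx r ((hR r).1 r.2).1) h
        have h2 : y r h = w r h := congrFun (hyw r) h
        have h3 : z r = y r := by simp [z]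
        exact (h1.trans (congrFun h3 h)).trans h2
  rw [← Set.ncard_image_of_injective _ hΦ, himage, ← Nat.card_coe_set_eq,
    Nat.card_congr (Equiv.Set.univPi _), Nat.card_pi]
  simp only [Nat.card_coe_set_eq]
  exact Finset.prod_coe_sort R (fun r => (treePatterns
    (reshapedBall p (leftPosition r) (n - r.length)) Y).ncard)

theorem log_ncard_treePatterns_multiplicativeAxialProduct {A : Type*} [Finite A]
    [TopologicalSpace A]
    {p : ℕ} (hp : 1 < p) {Ω : Set (ℕ → A)} (hΩ : IsOneSidedSubshift Ω) (X : Set (ℕ → A)) (n : ℕ)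
    {R : Finset BinTree} (hR : ∀ r, r ∈ R ↔ r ∈ independentVertices p ∧ r.length ≤ n) :
    Real.log (treePatterns (treeBall n) (multiplicativeAxialProduct p Ω X)).ncard =
      ∑ r ∈ R, Real.log (treePatterns (reshapedBall p (leftPosition r) (n - r.length))
        (axialProduct Ω X)).ncard := by
  rw [ncard_treePatterns_multiplicativeAxialProduct hp hΩ X n hR]
  by_cases hY : axialProduct Ω X = ∅
  · have h1R : (1 : BinTree) ∈ R := (hR 1).2 ⟨one_mem_independentVertices p, Nat.zero_le n⟩
    have h0 : ∀ Λ : Set BinTree, (treePatterns Λ (axialProduct Ω X)).ncard = 0 := fun Λ => by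
      rw [treePatterns_eq_empty_iff.2 hY, Set.ncard_empty]
    rw [Finset.prod_eq_zero h1R (h0 _), Nat.cast_zero, Real.log_zero]
    exact (Finset.sum_eq_zero fun r _ => by rw [h0, Nat.cast_zero, Real.log_zero]).symm
  · rw [Nat.cast_prod, Real.log_prod]
    intro r _
    have := (finite_reshapedBall hp (leftPosition_pos r) (n - r.length)).to_subtype
    have hne : (treePatterns (reshapedBall p (leftPosition r) (n - r.length))
        (axialProduct Ω X)).Nonempty :=
      Set.nonempty_iff_ne_empty.2 fun h => hY (treePatterns_eq_empty_iff.1 h)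
    exact Nat.cast_ne_zero.2 ((Set.ncard_pos (Set.toFinite _)).2 hne).ne'

/-! ### Counting vertices -/

theorem ncard_length_eq (m : ℕ) : {g : BinTree | g.length = m}.ncard = 2 ^ m := by
  rw [← Nat.card_coe_set_eq]
  have h : Nat.card (List.Vector (Fin 2) m) = 2 ^ m := by
    rw [Nat.card_eq_fintype_card, card_vector, Fintype.card_fin]
  exact h

theorem ncard_treeBall (n : ℕ) : (treeBall n).ncard + 1 = 2 ^ (n + 1) := by
  induction n with
  | zero =>
    have h : treeBall 0 = {g : BinTree | g.length = 0} := by ext g; simp [treeBall]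
    rw [h, ncard_length_eq, pow_zero, zero_add, pow_one]
  | succ n ih =>
    have h : treeBall (n + 1) = treeBall n ∪ {g : BinTree | g.length = n + 1} := by
      ext g
      simp only [treeBall, Set.mem_ofPred_eq, Set.mem_union]
      omega
    have hfin : {g : BinTree | g.length = n + 1}.Finite := List.finite_length_eq (Fin 2) (n + 1)
    rw [h, Set.ncard_union_eq _ (finite_treeBall n) hfin,
      ncard_length_eq, add_right_comm, ih]
    · ring
    · rw [Set.disjoint_left]
      intro g hg hg'
      simp only [treeBall, Set.mem_ofPred_eq] at hg hg'
      omega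

/-- The vertices of type `(i, 1)` at distance `m` from the root. -/
def verticesOfType (i m : ℕ) : Set BinTree := {g | leftPosition g = i ∧ g.length = m}

theorem ncard_verticesOfType_one (m : ℕ) : (verticesOfType 1 (m + 1)).ncard = 2 ^ m := by
  have h : verticesOfType 1 (m + 1) = (fun g => g * f₂) '' {g : BinTree | g.length = m} := by
    ext g
    constructor
    · rintro ⟨h1, h2⟩
      rcases g.eq_one_or_mul with rfl | h' | ⟨g', rfl⟩
      · simp at h2
      · exact absurd h' ((leftPosition_eq_one_iff g).1 h1)
      · rw [length_mul_f₂] at h2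
        exact ⟨g', Nat.succ_injective h2, rfl⟩
    · rintro ⟨g, hg, rfl⟩
      exact ⟨leftPosition_mul_f₂ g, by rw [length_mul_f₂, hg]⟩
  rw [h, Set.ncard_image_of_injective _ (mul_left_injective f₂), ncard_length_eq]

theorem ncard_verticesOfType_succ {i : ℕ} (hi : 0 < i) (m : ℕ) :
    (verticesOfType (i + 1) (m + 1)).ncard = (verticesOfType i m).ncard := by
  have hlen : ∀ g : BinTree, (g * f₁).length = g.length + 1 := fun g => by
    simpa using length_mul_f₁_pow g 1
  have h : verticesOfType (i + 1) (m + 1) = (fun g => g * f₁) '' verticesOfType i m := by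
    ext g
    constructor
    · rintro ⟨h1, h2⟩
      rcases g.eq_one_or_mul with rfl | ⟨g', rfl⟩ | ⟨g', rfl⟩
      · simp at h2
      · rw [leftPosition_mul_f₁] at h1
        rw [hlen] at h2
        exact ⟨g', ⟨Nat.succ_injective h1, Nat.succ_injective h2⟩, rfl⟩
      · rw [leftPosition_mul_f₂] at h1
        omega
    · rintro ⟨g, ⟨h1, h2⟩, rfl⟩
      exact ⟨by rw [leftPosition_mul_f₁, h1], by rw [hlen, h2]⟩
  rw [h, Set.ncard_image_of_injective _ (mul_left_injective f₁)]

theorem ncard_verticesOfType_add (i m : ℕ) :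
    (verticesOfType (i + 1) (m + (i + 1))).ncard = 2 ^ m := by
  induction i with
  | zero => exact ncard_verticesOfType_one m
  | succ i ih => rw [← add_assoc m, ncard_verticesOfType_succ i.succ_pos, ih]

theorem ncard_verticesOfType_mul_le (i m : ℕ) :
    (verticesOfType (i + 1) m).ncard * 2 ^ i ≤ 2 ^ m := by
  induction i generalizing m with
  | zero =>
    rw [pow_zero, mul_one, ← ncard_length_eq m]
    exact Set.ncard_le_ncard (fun g hg => hg.2) (List.finite_length_eq (Fin 2) m)
  | succ i ih =>
    rcases m with _ | m
    · have h : verticesOfType (i + 1 + 1) 0 = ∅ := by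
        rw [Set.eq_empty_iff_forall_notMem]
        rintro g ⟨h1, h2⟩
        rw [FreeMonoid.length_eq_zero.1 h2, leftPosition_one] at h1
        omega
      rw [h, Set.ncard_empty]
      omega
    · rw [ncard_verticesOfType_succ i.succ_pos, pow_succ, pow_succ, ← mul_assoc]
      exact Nat.mul_le_mul_right 2 (ih m)

/-- The proportion, among the vertices of `Δ_n`, of the vertices `g` of type `(i, 1)` for which
`g Δ_k` is the largest of the sets `g Δ_0, g Δ_1, …` contained in `Δ_n`. -/
noncomputable def typeFrequency (n k i : ℕ) : ℝ :=
  if k ≤ n then (verticesOfType i (n - k)).ncard / (treeBall n).ncard else 0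

theorem ncard_treeBall_cast (n : ℕ) : ((treeBall n).ncard : ℝ) = 2 ^ (n + 1) - 1 :=
  eq_sub_of_add_eq (by exact_mod_cast ncard_treeBall n)

theorem two_pow_le_ncard_treeBall (n : ℕ) : (2 : ℝ) ^ n ≤ (treeBall n).ncard := by
  have h1 : (1 : ℝ) ≤ 2 ^ n := one_le_pow₀ (by norm_num)
  rw [ncard_treeBall_cast, pow_succ]
  linarith

theorem tendsto_typeFrequency (k : ℕ) {i : ℕ} (hi : 0 < i) :
    Tendsto (fun n => typeFrequency n k i) atTop (𝓝 (1 / 2 ^ (k + i + 1))) := by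
  obtain ⟨i, rfl⟩ := Nat.exists_eq_succ_of_ne_zero hi.ne'
  have hlim : Tendsto (fun n : ℕ => (1 / 2 ^ (k + (i + 1) + 1) : ℝ) *
      (1 - (1 / 2) ^ (n + 1))⁻¹) atTop (𝓝 (1 / 2 ^ (k + (i + 1) + 1))) := by
    have h1 : Tendsto (fun n : ℕ => (1 / 2 : ℝ) ^ (n + 1)) atTop (𝓝 0) :=
      (tendsto_add_atTop_iff_nat 1).2
        (tendsto_pow_atTop_nhds_zero_of_lt_one (by norm_num) (by norm_num))
    have h2 := ((tendsto_const_nhds (x := (1 : ℝ))).sub h1).inv₀ (by norm_num)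
    simpa using h2.const_mul (1 / 2 ^ (k + (i + 1) + 1) : ℝ)
  refine hlim.congr' ?_
  filter_upwards [eventually_ge_atTop (k + (i + 1))] with n hn
  obtain ⟨m, rfl⟩ := Nat.exists_eq_add_of_le hn
  have h1 : k + (i + 1) + m - k = m + (i + 1) := by omega
  rw [typeFrequency, if_pos (by omega), h1, ncard_verticesOfType_add, ncard_treeBall_cast,
    Nat.cast_pow, Nat.cast_ofNat, one_div_pow]
  have h2 : (1 : ℝ) < 2 ^ (k + (i + 1) + m + 1) := one_lt_pow₀ (by norm_num) (by omega)
  have h3 : (2 : ℝ) ^ (k + (i + 1) + m + 1) - 1 ≠ 0 := by linarith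
  have h4 : (1 : ℝ) - 1 / 2 ^ (k + (i + 1) + m + 1) ≠ 0 := by
    rw [one_sub_div (by positivity)]
    exact div_ne_zero h3 (by positivity)
  field_simp
  ring

theorem typeFrequency_nonneg (n k i : ℕ) : 0 ≤ typeFrequency n k i := by
  rw [typeFrequency]
  split_ifs <;> positivity

theorem typeFrequency_le (n k : ℕ) {i : ℕ} (hi : 0 < i) :
    typeFrequency n k i ≤ 2 * ((1 / 2) ^ k * (1 / 2) ^ i) := by
  obtain ⟨i, rfl⟩ := Nat.exists_eq_succ_of_ne_zero hi.ne'
  rw [typeFrequency]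
  split_ifs with hk
  · obtain ⟨m, rfl⟩ := Nat.exists_eq_add_of_le hk
    have h1 : ((verticesOfType (i + 1) m).ncard : ℝ) * 2 ^ i ≤ 2 ^ m := by
      exact_mod_cast ncard_verticesOfType_mul_le i m
    have h2 := two_pow_le_ncard_treeBall (k + m)
    have h3 : (0 : ℝ) < 2 ^ (k + m) := by positivity
    rw [Nat.add_sub_cancel_left, Nat.succ_eq_add_one, div_le_iff₀ (h3.trans_le h2)]
    calc ((verticesOfType (i + 1) m).ncard : ℝ)
        ≤ 2 ^ m / 2 ^ i := (le_div_iff₀ (by positivity)).2 h1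
      _ = 2 * ((1 / 2) ^ k * (1 / 2) ^ (i + 1)) * 2 ^ (k + m) := by
          rw [one_div_pow, one_div_pow, pow_add, pow_succ]
          field_simp
          ring
      _ ≤ _ := by gcongr
  · positivity

/-! ### The entropy -/

/-- The logarithm of the number of patterns, normalized by the size of `Δ_n`, splits into the
contribution of the root and those of the types `(i, 1)` with `i > 1` not divisible by `p`. -/
theorem log_ncard_treePatterns_div_ncard_treeBall {A : Type*} [Finite A] [TopologicalSpace A]
    {p : ℕ} (hp : 1 < p) {Ω : Set (ℕ → A)} (hΩ : IsOneSidedSubshift Ω) (X : Set (ℕ → A)) (n : ℕ) :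
    Real.log (treePatterns (treeBall n) (multiplicativeAxialProduct p Ω X)).ncard /
        (treeBall n).ncard =
      Real.log (treePatterns (reshapedBall p 1 n) (axialProduct Ω X)).ncard / (treeBall n).ncard +
      ∑' q : ℕ × {i : ℕ // 1 < i ∧ ¬ p ∣ i}, typeFrequency n q.1 q.2 *
        Real.log (treePatterns (reshapedBall p q.2 q.1) (axialProduct Ω X)).ncard := by
  classical
  have hfin : (independentVertices p ∩ treeBall n).Finite :=
    (finite_treeBall n).subset Set.inter_subset_right
  set R : Finset BinTree := hfin.toFinset with hRdef
  have hR : ∀ r, r ∈ R ↔ r ∈ independentVertices p ∧ r.length ≤ n := fun r => by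
    rw [hRdef, Set.Finite.mem_toFinset]
    exact Iff.rfl
  rw [log_ncard_treePatterns_multiplicativeAxialProduct hp hΩ X n hR]
  have h1R : (1 : BinTree) ∈ R := (hR 1).2 ⟨one_mem_independentVertices p, Nat.zero_le n⟩
  rw [← Finset.add_sum_erase _ _ h1R, leftPosition_one, FreeMonoid.length_one, Nat.sub_zero,
    add_div]
  congr 1
  set F : ℕ × {i : ℕ // 1 < i ∧ ¬ p ∣ i} → ℝ := fun q =>
    Real.log (treePatterns (reshapedBall p q.2 q.1) (axialProduct Ω X)).ncard with hF
  have hmem : ∀ r : R.erase 1, 1 < leftPosition r.1 ∧ ¬ p ∣ leftPosition r.1 := fun r =>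
    ((hR r).1 (Finset.mem_of_mem_erase r.2)).1.resolve_left (Finset.ne_of_mem_erase r.2)
  let φ : R.erase 1 → ℕ × {i : ℕ // 1 < i ∧ ¬ p ∣ i} := fun r =>
    (n - r.1.length, ⟨leftPosition r.1, hmem r⟩)
  have hcount : ∀ q : ℕ × {i : ℕ // 1 < i ∧ ¬ p ∣ i},
      (((R.erase 1).attach.filter fun r => φ r = q).card : ℝ) / (treeBall n).ncard =
        typeFrequency n q.1 q.2 := by
    rintro ⟨k, i, hi1, hip⟩
    have hiff : ∀ r, φ r = (k, ⟨i, hi1, hip⟩) ↔ n - r.1.length = k ∧ leftPosition r.1 = i :=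
      fun r => by simp only [φ, Prod.mk.injEq, Subtype.mk.injEq]
    rw [typeFrequency]
    split_ifs with hk
    · congr 2
      rw [← Set.ncard_coe_finset, ← Set.ncard_image_of_injective _ Subtype.val_injective]
      congr 1
      ext g
      simp only [Set.mem_image, Finset.coe_filter, Finset.mem_attach, true_and, Set.mem_ofPred_eq,
        hiff, verticesOfType]
      constructor
      · rintro ⟨r, ⟨h1, h2⟩, rfl⟩
        have := ((hR r).1 (Finset.mem_of_mem_erase r.2)).2
        exact ⟨h2, by omega⟩
      · rintro ⟨h1, h2⟩
        refine ⟨⟨g, Finset.mem_erase.2 ⟨?_, (hR g).2 ⟨Or.inr ?_, by omega⟩⟩⟩, ⟨?_, h1⟩, rfl⟩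
        · rintro rfl
          rw [leftPosition_one] at h1
          omega
        · rw [h1]
          exact ⟨hi1, hip⟩
        · simp only [h2]
          omega
    · rw [Finset.filter_false_of_mem, Finset.card_empty, Nat.cast_zero, zero_div]
      intro r _ hr
      have := ((hiff r).1 hr).1
      omega
  have hsum : ∑ r ∈ R.erase 1, Real.log (treePatterns
      (reshapedBall p (leftPosition r) (n - r.length)) (axialProduct Ω X)).ncard =
      ∑ r ∈ (R.erase 1).attach, F (φ r) := (Finset.sum_attach _ _).symm
  rw [hsum, Finset.sum_comp, Finset.sum_div, tsum_eq_sum]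
  · refine Finset.sum_congr rfl fun q _ => ?_
    rw [← hcount q, nsmul_eq_mul]
    ring
  · intro q hq
    rw [← hcount q, Finset.filter_false_of_mem, Finset.card_empty, Nat.cast_zero, zero_div,
      zero_mul]
    rintro r hr rfl
    exact hq (Finset.mem_image_of_mem φ hr)

theorem summable_geometric_bound (p : ℕ) (C : ℝ) :
    Summable fun q : ℕ × {i : ℕ // 1 < i ∧ ¬ p ∣ i} =>
      C * ((19 / 20 : ℝ) ^ q.1 * (1 / 2 : ℝ) ^ (q.2 : ℕ)) := by
  have h1 : Summable fun k : ℕ => (19 / 20 : ℝ) ^ k :=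
    summable_geometric_of_lt_one (by norm_num) (by norm_num)
  have h2 : Summable fun i : {i : ℕ // 1 < i ∧ ¬ p ∣ i} => (1 / 2 : ℝ) ^ (i : ℕ) :=
    summable_geometric_two.comp_injective Subtype.val_injective
  have h3 := h1.mul_of_nonneg h2 (fun _ => pow_nonneg (by norm_num) _)
    fun _ => pow_nonneg (by norm_num) _
  exact h3.mul_left C

theorem mainTheorem3 {A : Type*} [Finite A] [TopologicalSpace A] [DiscreteTopology A]
    (p : ℕ) (hp : 1 < p) (Ω X : Set (ℕ → A))
    (hΩ : IsOneSidedSubshift Ω) (hX : IsOneSidedSubshift X) :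
    Summable (fun q : ℕ × {i : ℕ // 1 < i ∧ ¬ p ∣ i} =>
      (1 / 2 ^ (q.1 + (q.2 : ℕ) + 1) : ℝ) *
        Real.log ((treePatterns (reshapedBall p q.2 q.1) (axialProduct Ω X)).ncard : ℝ)) ∧
    HasTreeEntropy (multiplicativeAxialProduct p Ω X)
      (∑' k : ℕ, ∑' i : {i : ℕ // 1 < i ∧ ¬ p ∣ i},
        (1 / 2 ^ (k + (i : ℕ) + 1) : ℝ) *
          Real.log ((treePatterns (reshapedBall p i k) (axialProduct Ω X)).ncard : ℝ)) := by
  have hpow : ∀ k : ℕ, (19 / 10 : ℝ) ^ k * (1 / 2) ^ k = (19 / 20) ^ k := fun k => by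
    rw [← mul_pow]; norm_num
  -- one bound dominates both the series and its approximations on the balls `Δ_n`
  have hbound : ∀ (q : ℕ × {i : ℕ // 1 < i ∧ ¬ p ∣ i}) (c : ℝ), 0 ≤ c →
      c ≤ 2 * ((1 / 2) ^ q.1 * (1 / 2) ^ (q.2 : ℕ)) →
      ‖c * Real.log ((treePatterns (reshapedBall p q.2 q.1) (axialProduct Ω X)).ncard : ℝ)‖ ≤
        2 * (10 * Real.log (Nat.card A)) * ((19 / 20 : ℝ) ^ q.1 * (1 / 2 : ℝ) ^ (q.2 : ℕ)) := by
    rintro ⟨k, i, hi1, hip⟩ c hc0 hc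
    have hL := log_ncard_treePatterns_reshapedBall_le hp (by omega : 0 < i) k (axialProduct Ω X)
    have hL0 : 0 ≤ Real.log ((treePatterns (reshapedBall p i k) (axialProduct Ω X)).ncard : ℝ) :=
      Real.log_natCast_nonneg _
    rw [Real.norm_of_nonneg (mul_nonneg hc0 hL0)]
    refine (mul_le_mul hc hL hL0 (by positivity)).trans_eq ?_
    rw [← hpow k]
    ring
  have hsummable : Summable (fun q : ℕ × {i : ℕ // 1 < i ∧ ¬ p ∣ i} =>
      (1 / 2 ^ (q.1 + (q.2 : ℕ) + 1) : ℝ) *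
        Real.log ((treePatterns (reshapedBall p q.2 q.1) (axialProduct Ω X)).ncard : ℝ)) := by
    refine Summable.of_norm_bounded (summable_geometric_bound p _)
      fun q => hbound q _ (by positivity) ?_
    rw [one_div_pow, one_div_pow, pow_add, pow_add]
    have h : (0 : ℝ) ≤ 1 / 2 ^ q.1 * (1 / 2 ^ (q.2 : ℕ)) := by positivity
    calc (1 : ℝ) / (2 ^ q.1 * 2 ^ (q.2 : ℕ) * 2 ^ 1)
        = 1 / 2 ^ q.1 * (1 / 2 ^ (q.2 : ℕ)) / 2 := by field_simp
      _ ≤ _ := by linarith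
  refine ⟨hsummable, ?_⟩
  have hmain : Tendsto (fun n => ∑' q : ℕ × {i : ℕ // 1 < i ∧ ¬ p ∣ i}, typeFrequency n q.1 q.2 *
      Real.log ((treePatterns (reshapedBall p q.2 q.1) (axialProduct Ω X)).ncard : ℝ)) atTop
      (𝓝 (∑' q : ℕ × {i : ℕ // 1 < i ∧ ¬ p ∣ i}, (1 / 2 ^ (q.1 + (q.2 : ℕ) + 1) : ℝ) *
        Real.log ((treePatterns (reshapedBall p q.2 q.1) (axialProduct Ω X)).ncard : ℝ))) := by
    refine tendsto_tsum_of_dominated_convergence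
      (summable_geometric_bound p (2 * (10 * Real.log (Nat.card A)))) (fun q => ?_)
      (Eventually.of_forall fun n q => hbound q _ (typeFrequency_nonneg _ _ _)
        (typeFrequency_le n q.1 (by have := q.2.2.1; omega)))
    exact (tendsto_typeFrequency q.1 (by have := q.2.2.1; omega)).mul_const _
  -- the class of the root is too sparse to contribute to the limit
  have hroot : Tendsto (fun n => Real.log
      (treePatterns (reshapedBall p 1 n) (axialProduct Ω X)).ncard / (treeBall n).ncard) atTop
      (𝓝 0) := by
    have hgeom : Tendsto (fun n : ℕ => 10 * Real.log (Nat.card A) * (19 / 20 : ℝ) ^ n) atTop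
        (𝓝 0) := by
      simpa using (tendsto_pow_atTop_nhds_zero_of_lt_one (r := (19 / 20 : ℝ)) (by norm_num)
        (by norm_num)).const_mul (10 * Real.log (Nat.card A))
    refine squeeze_zero (fun n => div_nonneg (Real.log_natCast_nonneg _) (Nat.cast_nonneg _))
      (fun n => ?_) hgeom
    have hC : 0 ≤ Real.log (Nat.card A : ℝ) := Real.log_natCast_nonneg _
    refine (div_le_div₀ (by positivity)
      (log_ncard_treePatterns_reshapedBall_le hp Nat.one_pos n (axialProduct Ω X))
      (by positivity) (two_pow_le_ncard_treeBall n)).trans_eq ?_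
    rw [← hpow n, one_div_pow]
    ring
  rw [HasTreeEntropy, ← hsummable.tsum_prod]
  simpa only [log_ncard_treePatterns_div_ncard_treeBall hp hΩ X, zero_add] using hroot.add hmain
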